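/- The game of Cops and Robbers with a robber of speed $R\in(0,\infty]$ is played on a finite graph $G$ with perfect information. First $k$ cops are placed on vertices of $G$ (several may share a vertex), then the robber chooses a vertex. After that, in each round, first every cop stays put or moves along one edge, and then the robber moves along a walk of length at most $R$ (of any finite length if $R=\infty$; he may stay put) that contains no vertex occupied by a cop. The cops win if at some time a cop and the robber are on the same vertex; otherwise, i.e. if he eludes them forever, the robber wins. We say that $G$ requires at least $x$ cops if the smallest number of cops that have a winning strategy on $G$ is at least $x$, and that the robber can always escape from $x$ cops if, for each integer $0\le k\le x$, he has a strategy that eludes $k$ cops forever, whatever they do. $G_{n,p}$ is the random graph on $n$ labelled vertices in which each pair is an edge independently with probability $p$ (read $\min(p,1)$ if $p>1$), and "whp" means with probability tending to $1$ as $n\to\infty$. (i) For every real $R$ with $2<R<\infty$ and all sufficiently large $n$ (depending on $R$), there is a connected $n$-vertex graph that requires at least $n^{1-\frac{1}{R-2}}$ cops against a robber of speed $R$. (ii) For all sufficiently large $n$, there is a connected $n$-vertex graph that requires at least $\frac{n}{800^2}$ cops against a robber of infinite speed. Moreover, the corresponding statements hold for random graphs: (i') For every fixed real $c>0$ and $p=\frac{c^3}{30000}\,n^{c-1}$,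 whp $G_{n,p}$ has the property that a robber of speed $\frac1c+2$ can always escape from $n^{1-c}$ cops. (ii') For $p=\frac{200}{n}$, whp $G_{n,p}$ has the property that a robber of infinite speed can always escape from $\frac{n}{800^2}$ cops. -/

import Mathlib

open Filter Topology
open scoped ENNReal

namespace CopsAndRobbers

variable {V : Type*}

/-- `history x t` is the list `[x (t-1), …, x 1, x 0]` of the first `t` terms of the sequence `x`,
most recent term first. -/
def history {α : Type*} (x : ℕ → α) : ℕ → List α
  | 0 => []
  | t + 1 => x t :: history x t

/-- A legal move of `k` cops from the positions `c` to the positions `c'`: each cop stays where it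
is or moves along one edge. Several cops may share a vertex. -/
def CopMove (G : SimpleGraph V) {k : ℕ} (c c' : Fin k → V) : Prop :=
  ∀ i, c' i = c i ∨ G.Adj (c i) (c' i)

/-- A legal move of a robber of speed `R` (possibly `R = ∞`) from `r` to `r'`, while the cops are at
the positions `c`: he follows a walk of length at most `R`, none of whose vertices is occupied by a
cop. (If a cop has just stepped onto `r`, the robber is caught and there is no legal move.) -/
def RobberMove (G : SimpleGraph V) (R : ℝ≥0∞) {k : ℕ} (c : Fin k → V) (r r' : V) : Prop :=
  ∃ w : G.Walk r r', (w.length : ℝ≥0∞) ≤ R ∧ ∀ v ∈ w.support, ∀ i, c i ≠ v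

/-- A play in which the robber is never caught. First the cops are at `c 0` and the robber chooses
`r 0`; then, in round `t`, the cops move from `c t` to `c (t + 1)`, and after that the robber moves
from `r t` to `r (t + 1)`. -/
def Evades (G : SimpleGraph V) (R : ℝ≥0∞) {k : ℕ} (c : ℕ → Fin k → V) (r : ℕ → V) : Prop :=
  (∀ i, c 0 i ≠ r 0) ∧ ∀ t, RobberMove G R (c (t + 1)) (r t) (r (t + 1))

/-- `k` cops win against a robber of speed `R` on `G`: the cops have a strategy `σ`, which computes
their next positions from all positions that the robber has taken so far (so that `σ []` is the
initial placement), and against which no play of the robber evades capture forever. -/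
def CopsWin (G : SimpleGraph V) (R : ℝ≥0∞) (k : ℕ) : Prop :=
  ∃ σ : List V → Fin k → V, (∀ h v, CopMove G (σ h) (σ (v :: h))) ∧
    ∀ r : ℕ → V, ¬ Evades G R (fun t => σ (history r t)) r

/-- A robber of speed `R` can always escape from `k` cops on `G`: the robber has a strategy `ρ`,
which computes his next position from all positions that the cops have taken so far (the current
ones included), and which evades capture forever, whatever legal moves the cops make. -/
def RobberEscapes (G : SimpleGraph V) (R : ℝ≥0∞) (k : ℕ) : Prop :=
  ∃ ρ : List (Fin k → V) → V, ∀ c : ℕ → Fin k → V, (∀ t, CopMove G (c t) (c (t + 1))) →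
    Evades G R c (fun t => ρ (history c (t + 1)))

/-- The cop number of `G` against a robber of speed `R`: the minimum number of cops that win.
(On a finite graph the set is not empty: one cop on every vertex suffices.) -/
noncomputable def copNumber (G : SimpleGraph V) (R : ℝ≥0∞) : ℕ :=
  sInf {k : ℕ | CopsWin G R k}

/-- With high probability, the random graph `G(n, p n)` on the vertex set `Fin n` has the property
`P n`: the probability tends to `1` as `n → ∞`. The edge probability is `p n`, truncated to the
interval `[0, 1]`. -/
def Whp (p : ℕ → ℝ) (P : ∀ n : ℕ, SimpleGraph (Fin n) → Prop) : Prop :=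
  Tendsto (fun n : ℕ =>
      SimpleGraph.binomialRandom (Fin n) (Set.projIcc (0 : ℝ) 1 zero_le_one (p n)) {G | P n G})
    atTop (𝓝 1)

end CopsAndRobbers

/-!
The robber lives in an expander that the cops cannot reach with their next move. Call a graph on `n`
vertices robust if (1) any set of `a` vertices is joined by an edge to any disjoint set of more than
`n / 10` vertices, and (2) any `k` vertices have at most `n / 5` neighbours besides themselves.
Given cops at `c`, delete their closed neighbourhood. By (2) a set `W` with most of the vertices is left,
and by (1) it contains a set `U c`, smaller than `W` by less than `a`, in which every set of at most
`a` vertices grows by the factor `F = n / (4 * a)`: delete a maximal set that fails to grow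
(`JoinsLarge.exists_expanding`). If `a ≤ F ^ m`, then from any vertex of `U c` a walk of length
`m + 1` inside `U c` reaches by (1) all of `U c` but `n / 10` vertices. That is enough to meet the
set `U c'` for any next position `c'` of the cops. They cannot have stepped into `U c`, so this move
is safe, and the robber escapes if his speed is at least `m + 1` (`JoinsLarge.robberEscapes`).

Random graphs are robust by crude union bounds over the `4 ^ n` pairs of vertex sets (`whp_robust`).
In `G(n, p)` with `p` of order `n ^ (c - 1)` one takes `k = n ^ (1 - c)` and `a` a large multiple of
`n ^ (1 - c)`, so `F` has order `n ^ c` and `m = ⌊1 / c⌋ + 1` steps suffice; for `p = 200 / n` one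
takes `a` about `n / 10`, and `F = 2`. If `c > 1` there is less than one cop.

The connected graphs arise from robust graphs by adding a Hamiltonian path. This preserves (1), and
it adds at most two neighbours per cop, which is harmless because `3 * k ≤ a`.
-/

namespace CopsAndRobbers

variable {V : Type*}

/-! ### Strategies and the cop number -/

theorem RobberMove.refl (G : SimpleGraph V) (R : ℝ≥0∞) {k : ℕ} {c : Fin k → V} {r : V}
    (h : ∀ i, c i ≠ r) : RobberMove G R c r r :=
  ⟨.nil, by simp, by simpa using h⟩

/-- The robber escapes as soon as every cop position `c` admits a nonempty set `U c` of vertices,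
none of them occupied, such that from a vertex of `U c` he can always answer a cop move from `c` to
`c'` by a move into `U c'`. -/
theorem robberEscapes_of_safe_sets (G : SimpleGraph V) (R : ℝ≥0∞) {k : ℕ}
    (U : (Fin k → V) → Set V) (hne : ∀ c, (U c).Nonempty)
    (hfree : ∀ c, ∀ r ∈ U c, ∀ i, c i ≠ r)
    (hmove : ∀ c c', CopMove G c c' → ∀ r ∈ U c, ∃ r' ∈ U c', RobberMove G R c' r r')
    (v₀ : V) : RobberEscapes G R k := by
  classical
  let next : (Fin k → V) → V → V := fun c' r =>
    if h : ∃ r' ∈ U c', RobberMove G R c' r r' then h.choose else r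
  let ρ : List (Fin k → V) → V := fun l => l.rec v₀
    (fun c' t ih => match t with
      | [] => (hne c').choose
      | _ :: _ => next c' ih)
  have key : ∀ c : ℕ → Fin k → V, (∀ t, CopMove G (c t) (c (t + 1))) → ∀ t,
      ρ (history c (t + 1)) ∈ U (c t) := by
    intro c hc t
    induction t with
    | zero => exact (hne (c 0)).choose_spec
    | succ t ih =>
      have h := hmove _ _ (hc t) _ ih
      change next (c (t + 1)) (ρ (history c (t + 1))) ∈ _
      simp only [next, dif_pos h]
      exact h.choose_spec.1
  refine ⟨ρ, fun c hc => ⟨hfree _ _ (key c hc 0), fun t => ?_⟩⟩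
  have h := hmove _ _ (hc t) _ (key c hc t)
  change RobberMove G R _ _ (next (c (t + 1)) (ρ (history c (t + 1))))
  simp only [next, dif_pos h]
  exact h.choose_spec.2

theorem robberEscapes_zero (G : SimpleGraph V) (R : ℝ≥0∞) (v₀ : V) : RobberEscapes G R 0 :=
  robberEscapes_of_safe_sets G R (fun _ => Set.univ) (fun _ => ⟨v₀, trivial⟩)
    (fun _ _ _ i => i.elim0) (fun _ _ _ r _ => ⟨r, trivial, .refl G R fun i => i.elim0⟩) v₀

/-- The histories of the cops' and of the robber's positions after `t` rounds, when the cops follow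
the strategy `σ` and the robber follows the strategy `ρ`. -/
def playHistories {k : ℕ} (σ : List V → Fin k → V) (ρ : List (Fin k → V) → V) :
    ℕ → List (Fin k → V) × List V
  | 0 => ([], [])
  | t + 1 =>
    let h := playHistories σ ρ t
    (σ h.2 :: h.1, ρ (σ h.2 :: h.1) :: h.2)

theorem RobberEscapes.not_copsWin {G : SimpleGraph V} {R : ℝ≥0∞} {k : ℕ}
    (h : RobberEscapes G R k) : ¬ CopsWin G R k := by
  rintro ⟨σ, hσ, hwin⟩
  obtain ⟨ρ, hρ⟩ := h
  let H := playHistories σ ρ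
  let c : ℕ → Fin k → V := fun t => σ (H t).2
  let r : ℕ → V := fun t => ρ (H (t + 1)).1
  have hc : ∀ t, history c t = (H t).1 := by
    intro t
    induction t with
    | zero => rfl
    | succ t ih => rw [history, ih]; rfl
  have hr : ∀ t, history r t = (H t).2 := by
    intro t
    induction t with
    | zero => rfl
    | succ t ih => rw [history, ih]; rfl
  have h1 : (fun t => σ (history r t)) = c := by funext t; rw [hr]
  have h2 : (fun t => ρ (history c (t + 1))) = r := by funext t; rw [hc]
  apply hwin r
  rw [h1, ← h2]
  exact hρ c fun t => hσ _ _

theorem copsWin_card {n : ℕ} (G : SimpleGraph (Fin n)) (R : ℝ≥0∞) : CopsWin G R n :=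
  ⟨fun _ => id, fun _ _ _ => .inl rfl, fun r h => h.1 (r 0) rfl⟩

theorem lt_copNumber {n : ℕ} {G : SimpleGraph (Fin n)} {R : ℝ≥0∞} {x : ℝ}
    (h : ∀ k : ℕ, (k : ℝ) ≤ x → RobberEscapes G R k) : x < copNumber G R := by
  by_contra! hx
  exact (h _ hx).not_copsWin (Nat.sInf_mem (s := {k | CopsWin G R k}) ⟨n, copsWin_card G R⟩)

/-! ### Expansion from edges between large sets -/

/-- Any two disjoint sets of vertices of sizes at least `a` and at least `b` are joined by an
edge. -/
def JoinsLarge (G : SimpleGraph V) (a b : ℕ) : Prop :=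
  ∀ A B : Finset V, Disjoint A B → a ≤ A.card → b ≤ B.card → ∃ u ∈ A, ∃ v ∈ B, G.Adj u v

open Classical in
/-- The closed neighbourhood of `A`: the vertices of `A` and their neighbours. -/
noncomputable def closedNbhd [Fintype V] (G : SimpleGraph V) (A : Finset V) : Finset V :=
  {v | ∃ u ∈ A, v = u ∨ G.Adj u v}

section
variable [Fintype V] {G : SimpleGraph V}

theorem mem_closedNbhd {A : Finset V} {v : V} :
    v ∈ closedNbhd G A ↔ ∃ u ∈ A, v = u ∨ G.Adj u v := by
  simp [closedNbhd]

theorem subset_closedNbhd (A : Finset V) : A ⊆ closedNbhd G A :=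
  fun v hv => mem_closedNbhd.2 ⟨v, hv, .inl rfl⟩

variable [DecidableEq V]

theorem JoinsLarge.card_sdiff_closedNbhd_lt {a b : ℕ} (hG : JoinsLarge G a b) {A : Finset V}
    (hA : a ≤ A.card) (W : Finset V) : (W \ closedNbhd G A).card < b := by
  by_contra! hb
  have hd : Disjoint A (W \ closedNbhd G A) :=
    Finset.disjoint_left.2 fun v hv hv' =>
      (Finset.mem_sdiff.1 hv').2 (subset_closedNbhd A hv)
  obtain ⟨u, hu, v, hv, huv⟩ := hG A _ hd hA hb
  exact (Finset.mem_sdiff.1 hv).2 (mem_closedNbhd.2 ⟨u, hu, .inr huv⟩)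

/-- A large set `W` becomes an expander after the deletion of fewer than `a` vertices: every
nonempty subset of size at most `a` grows by a factor more than `F`. The deleted set is a maximal
set that fails to expand. It cannot be large, because large sets reach almost everything. -/
theorem JoinsLarge.exists_expanding {a b F : ℕ} (hG : JoinsLarge G a b) (ha : 0 < a)
    (W : Finset V) (hW : 2 * a * F + b ≤ W.card) :
    ∃ U ⊆ W, W.card < U.card + a ∧
      ∀ A ⊆ U, A.Nonempty → A.card ≤ a → F * A.card < (U ∩ closedNbhd G A).card := by
  let fam : Finset (Finset V) :=
    W.powerset.filter fun Z => Z.card < 2 * a ∧ (W ∩ closedNbhd G Z).card ≤ F * Z.card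
  have h0 : (∅ : Finset V) ∈ fam := by
    have h : closedNbhd G ∅ = ∅ := by ext v; simp [mem_closedNbhd]
    simp [fam, ha, h]
  obtain ⟨Z, hZ, hmax⟩ := fam.exists_max_image Finset.card ⟨∅, h0⟩
  simp only [fam, Finset.mem_filter, Finset.mem_powerset] at hZ hmax
  obtain ⟨hZW, hZa, hZF⟩ := hZ
  have hZlt : Z.card < a := by
    by_contra! h
    have h1 := hG.card_sdiff_closedNbhd_lt h W
    have h2 := Finset.card_inter_add_card_sdiff W (closedNbhd G Z)
    have h3 : F * Z.card ≤ F * (2 * a) := Nat.mul_le_mul_left _ hZa.le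
    nlinarith
  refine ⟨W \ Z, Finset.sdiff_subset, ?_, fun A hA hne hAa => ?_⟩
  · have := Finset.card_sdiff_add_card_eq_card hZW
    omega
  · by_contra! hbad
    have hdisj : Disjoint Z A :=
      Finset.disjoint_left.2 fun v hv hv' => (Finset.mem_sdiff.1 (hA hv')).2 hv
    have hcard := Finset.card_union_of_disjoint hdisj
    have hsub : W ∩ closedNbhd G (Z ∪ A) ⊆
        (W ∩ closedNbhd G Z) ∪ ((W \ Z) ∩ closedNbhd G A) := by
      intro v hv
      simp only [Finset.mem_inter, Finset.mem_union, Finset.mem_sdiff, mem_closedNbhd] at hv ⊢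
      obtain ⟨hvW, u, hu, huv⟩ := hv
      by_cases hvZ : v ∈ Z
      · exact .inl ⟨hvW, v, hvZ, .inl rfl⟩
      · rcases hu with hu | hu
        · exact .inl ⟨hvW, u, hu, huv⟩
        · exact .inr ⟨⟨hvW, hvZ⟩, u, hu, huv⟩
    have h1 := (Finset.card_le_card hsub).trans (Finset.card_union_le _ _)
    have h2 := hmax (Z ∪ A) ⟨Finset.union_subset hZW (hA.trans Finset.sdiff_subset),
      by omega, by rw [hcard, mul_add]; omega⟩
    have := hne.card_pos
    omega

/-- The ball of radius `i` around `v` in the subgraph of `G` induced on `U`. -/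
noncomputable def ballIn (G : SimpleGraph V) (U : Finset V) (v : V) : ℕ → Finset V
  | 0 => {v}
  | i + 1 => U ∩ closedNbhd G (ballIn G U v i)

theorem ballIn_subset {U : Finset V} {v : V} (hv : v ∈ U) (i : ℕ) : ballIn G U v i ⊆ U := by
  cases i with
  | zero => simpa [ballIn] using hv
  | succ i => exact Finset.inter_subset_left

theorem ballIn_subset_succ {U : Finset V} {v : V} (hv : v ∈ U) (i : ℕ) :
    ballIn G U v i ⊆ ballIn G U v (i + 1) :=
  Finset.subset_inter (ballIn_subset hv i) (subset_closedNbhd _)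

theorem mem_ballIn_self {U : Finset V} {v : V} (hv : v ∈ U) (i : ℕ) : v ∈ ballIn G U v i := by
  induction i with
  | zero => simp [ballIn]
  | succ i ih => exact ballIn_subset_succ hv i ih

theorem exists_walk_of_mem_ballIn {U : Finset V} {v : V} (hv : v ∈ U) {i : ℕ} {w : V}
    (hw : w ∈ ballIn G U v i) : ∃ p : G.Walk v w, p.length ≤ i ∧ ∀ x ∈ p.support, x ∈ U := by
  induction i generalizing w with
  | zero =>
    obtain rfl : w = v := by simpa [ballIn] using hw
    exact ⟨.nil, by simp, by simpa using hv⟩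
  | succ i ih =>
    obtain ⟨hwU, hw⟩ := Finset.mem_inter.1 hw
    obtain ⟨u, hu, rfl | huw⟩ := mem_closedNbhd.1 hw
    · obtain ⟨p, hp, hpU⟩ := ih hu
      exact ⟨p, by omega, hpU⟩
    · obtain ⟨p, hp, hpU⟩ := ih hu
      refine ⟨p.concat huw, by simp [hp], fun x hx => ?_⟩
      rw [SimpleGraph.Walk.support_concat] at hx
      simp only [List.mem_append, List.mem_singleton] at hx
      rcases hx with hx | rfl
      · exact hpU x hx
      · exact hwU

/-- In an expanding set `U`, balls grow by a factor `F` until they have size `a`. -/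
theorem le_card_ballIn {U : Finset V} {a F : ℕ}
    (hU : ∀ A ⊆ U, A.Nonempty → A.card ≤ a → F * A.card < (U ∩ closedNbhd G A).card)
    {v : V} (hv : v ∈ U) (i : ℕ) :
    F ^ i ≤ (ballIn G U v i).card ∨ a ≤ (ballIn G U v i).card := by
  induction i with
  | zero => left; simp [ballIn]
  | succ i ih =>
    by_cases h : a ≤ (ballIn G U v i).card
    · exact .inr (h.trans (Finset.card_le_card (ballIn_subset_succ hv i)))
    · left
      have h1 := hU (ballIn G U v i) (ballIn_subset hv i) ⟨v, mem_ballIn_self hv i⟩ (not_le.1 h).le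
      have h2 : F ^ i ≤ (ballIn G U v i).card := ih.resolve_right h
      calc F ^ (i + 1) = F * F ^ i := by ring
        _ ≤ F * (ballIn G U v i).card := Nat.mul_le_mul_left _ h2
        _ ≤ _ := h1.le

/-- If the closed neighbourhood of any `k` vertices has size at most `s` and large sets are joined
by edges, then the robber escapes from `k` cops: against cops at `c` he stays in an expanding set
`U c` of more than `n - s - a` vertices outside the closed neighbourhood of the cops. Within this
set, which the cops cannot enter by their next move, he reaches all but `s + a + b` vertices of the
graph, hence also some vertex of the next expanding set. -/
theorem JoinsLarge.robberEscapes {a b F m s k : ℕ} (hG : JoinsLarge G a b) (ha : 0 < a)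
    (hs : ∀ C : Finset V, C.card ≤ k → (closedNbhd G C).card ≤ s)
    (h1 : 2 * a * F + b + s ≤ Fintype.card V) (h2 : 2 * s + 2 * a + b ≤ Fintype.card V)
    (hF : a ≤ F ^ m) {R : ℝ≥0∞} (hR : ((m + 1 : ℕ) : ℝ≥0∞) ≤ R) :
    RobberEscapes G R k := by
  classical
  let N : (Fin k → V) → Finset V := fun c => closedNbhd G (Finset.univ.image c)
  have hN : ∀ c, (N c).card + (Finset.univ \ N c).card = Fintype.card V ∧ (N c).card ≤ s := by
    intro c
    refine ⟨?_, hs _ (Finset.card_image_le.trans (by simp))⟩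
    rw [add_comm, Finset.card_sdiff_add_card_eq_card (Finset.subset_univ _), Finset.card_univ]
  have hex : ∀ c : Fin k → V, ∃ U ⊆ Finset.univ \ N c, (Finset.univ \ N c).card < U.card + a ∧
      ∀ A ⊆ U, A.Nonempty → A.card ≤ a → F * A.card < (U ∩ closedNbhd G A).card := fun c =>
    hG.exists_expanding ha _ (by have := hN c; omega)
  choose U hUN hUcard hUexp using hex
  have hUN' : ∀ c, ∀ v ∈ U c, v ∉ N c := fun c v hv => (Finset.mem_sdiff.1 (hUN c hv)).2
  have hne : ∀ c, (U c).Nonempty := fun c => by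
    rw [← Finset.card_pos]
    have := hN c
    have := hUcard c
    omega
  have hV : Nonempty V := Fintype.card_pos_iff.1 (by omega)
  refine robberEscapes_of_safe_sets G R (fun c => (U c : Set V)) (fun c => by simpa using hne c)
    (fun c r hr i hi => hUN' c r hr (mem_closedNbhd.2 ⟨c i, by simp, .inl hi.symm⟩))
    (fun c c' hcc r hr => ?_) hV.some
  replace hr : r ∈ U c := hr
  have hball : a ≤ (ballIn G (U c) r m).card := by
    rcases le_card_ballIn (hUexp c) hr m with h | h
    · exact hF.trans h
    · exact h
  have hrest := hG.card_sdiff_closedNbhd_lt hball (U c)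
  have hsplit := Finset.card_inter_add_card_sdiff (U c) (closedNbhd G (ballIn G (U c) r m))
  have hmeet : ∃ w ∈ ballIn G (U c) r (m + 1), w ∈ U c' := by
    by_contra! hno
    have hd : Disjoint (ballIn G (U c) r (m + 1)) (U c') := Finset.disjoint_left.2 hno
    have hle := Finset.card_le_univ (ballIn G (U c) r (m + 1) ∪ U c')
    rw [Finset.card_union_of_disjoint hd] at hle
    have e : (ballIn G (U c) r (m + 1)).card =
        (U c ∩ closedNbhd G (ballIn G (U c) r m)).card := by
      rw [ballIn]
    have := hN c
    have := hN c'
    have := hUcard c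
    have := hUcard c'
    omega
  obtain ⟨w, hw, hwU⟩ := hmeet
  obtain ⟨p, hp, hpU⟩ := exists_walk_of_mem_ballIn hr hw
  refine ⟨w, hwU, p, le_trans (by exact_mod_cast hp) hR, fun x hx i hi => ?_⟩
  refine hUN' c x (hpU x hx) (mem_closedNbhd.2 ⟨c i, by simp, ?_⟩)
  rw [← hi]
  exact hcc i

end

/-! ### Union bounds in the binomial random graph -/

open MeasureTheory ProbabilityTheory unitInterval

theorem setBernoulli_real_forall_mem {ι : Type*} (u : Set ι) (p : I) (F : Finset ι)
    (hF : ∀ i ∈ F, i ∈ u) :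
    (setBernoulli u p).real {S | ∀ i ∈ F, i ∈ S} = (p : ℝ) ^ F.card := by
  classical
  have e : (fun q : ι → Prop => {i | q i}) ⁻¹' {S | ∀ i ∈ F, i ∈ S} =
      Set.pi (F : Set ι) fun _ => {True} := by
    ext q; simp [Set.mem_pi]
  rw [measureReal_def, setBernoulli_apply', e, Measure.infinitePi_pi _ (by simp)]
  rw [Finset.prod_congr rfl (g := fun _ => ((toNNReal p : NNReal) : ℝ≥0∞))]
  · simp
  · intro i hi
    simp [hF i hi]

theorem setBernoulli_real_forall_notMem {ι : Type*} (u : Set ι) (p : I) (F : Finset ι)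
    (hF : ∀ i ∈ F, i ∈ u) :
    (setBernoulli u p).real {S | ∀ i ∈ F, i ∉ S} = (1 - p : ℝ) ^ F.card := by
  classical
  have e : (fun q : ι → Prop => {i | q i}) ⁻¹' {S | ∀ i ∈ F, i ∉ S} =
      Set.pi (F : Set ι) fun _ => {False} := by
    ext q; simp [Set.mem_pi]
  rw [measureReal_def, setBernoulli_apply', e, Measure.infinitePi_pi _ (by simp)]
  rw [Finset.prod_congr rfl (g := fun _ => ((toNNReal (σ p) : NNReal) : ℝ≥0∞))]
  · simp
  · intro i hi
    simp [hF i hi]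

section
variable [Finite V] (p : I)

theorem binomialRandom_real_forall_mem (F : Finset (Sym2 V)) (hF : ∀ e ∈ F, ¬ e.IsDiag) :
    (SimpleGraph.binomialRandom V p).real {G | ∀ e ∈ F, e ∈ G.edgeSet} = (p : ℝ) ^ F.card := by
  have hm : MeasurableSet {G : SimpleGraph V | ∀ e ∈ F, e ∈ G.edgeSet} :=
    SimpleGraph.measurable_edgeSet (t := {S | ∀ e ∈ F, e ∈ S}) (Set.toFinite _).measurableSet
  rw [SimpleGraph.binomialRandom_eq_map, measureReal_def,
    Measure.map_apply SimpleGraph.measurable_fromEdgeSet hm, ← measureReal_def,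
    ← setBernoulli_real_forall_mem Sym2.diagSetᶜ p F (by simpa using hF)]
  congr 1
  ext S
  exact forall₂_congr fun e he => by simp [hF e he]

theorem binomialRandom_real_forall_notMem (F : Finset (Sym2 V)) (hF : ∀ e ∈ F, ¬ e.IsDiag) :
    (SimpleGraph.binomialRandom V p).real {G | ∀ e ∈ F, e ∉ G.edgeSet} = (1 - p : ℝ) ^ F.card := by
  have hm : MeasurableSet {G : SimpleGraph V | ∀ e ∈ F, e ∉ G.edgeSet} :=
    SimpleGraph.measurable_edgeSet (t := {S | ∀ e ∈ F, e ∉ S}) (Set.toFinite _).measurableSet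
  rw [SimpleGraph.binomialRandom_eq_map, measureReal_def,
    Measure.map_apply SimpleGraph.measurable_fromEdgeSet hm, ← measureReal_def,
    ← setBernoulli_real_forall_notMem Sym2.diagSetᶜ p F (by simpa using hF)]
  congr 1
  ext S
  exact forall₂_congr fun e he => by simp [hF e he]

theorem binomialRandom_real_no_edge_between {A B : Finset V} (h : Disjoint A B) :
    (SimpleGraph.binomialRandom V p).real {G | ∀ u ∈ A, ∀ v ∈ B, ¬ G.Adj u v} =
      (1 - p : ℝ) ^ (A.card * B.card) := by
  classical
  have hAB : ∀ u ∈ A, ∀ v ∈ B, u ≠ v := fun u hu v hv => Finset.disjoint_iff_ne.1 h u hu v hv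
  let F : Finset (Sym2 V) := (A ×ˢ B).image fun x => s(x.1, x.2)
  have hF : F.card = A.card * B.card := by
    rw [Finset.card_image_of_injOn, Finset.card_product]
    rintro ⟨u, v⟩ hx ⟨u', v'⟩ hy hxy
    simp only [Finset.coe_product, Set.mem_prod, Finset.mem_coe] at hx hy
    rcases Sym2.eq_iff.1 hxy with ⟨rfl, rfl⟩ | ⟨h1, h2⟩
    · rfl
    · exact absurd h1 (hAB u hx.1 v' hy.2)
  rw [← hF, ← binomialRandom_real_forall_notMem p F]
  · congr 1
    ext G
    simp only [Set.mem_ofPred_eq, F, Finset.forall_mem_image, Finset.mem_product, Prod.forall,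
      SimpleGraph.mem_edgeSet]
    tauto
  · simp only [F, Finset.mem_image, Finset.mem_product]
    rintro _ ⟨⟨u, v⟩, hx, rfl⟩
    simpa using hAB u hx.1 v hx.2

/-- Union bound over the maps that choose for every vertex of `N` a neighbour in `C`. -/
theorem binomialRandom_real_dominated_le {C N : Finset V} (h : Disjoint C N) :
    (SimpleGraph.binomialRandom V p).real {G | ∀ v ∈ N, ∃ u ∈ C, G.Adj u v} ≤
      (C.card * p : ℝ) ^ N.card := by
  classical
  have hCN : ∀ u ∈ C, ∀ v ∈ N, u ≠ v := fun u hu v hv => Finset.disjoint_iff_ne.1 h u hu v hv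
  let μ := SimpleGraph.binomialRandom V p
  let E : (∀ v ∈ N, V) → Set (SimpleGraph V) := fun g => {G | ∀ v, ∀ hv : v ∈ N, G.Adj (g v hv) v}
  have hsub : {G : SimpleGraph V | ∀ v ∈ N, ∃ u ∈ C, G.Adj u v} ⊆
      ⋃ g ∈ N.pi fun _ => C, E g := by
    intro G hG
    choose g hg hadj using hG
    simp only [Set.mem_iUnion]
    exact ⟨g, Finset.mem_pi.2 hg, hadj⟩
  have hE : ∀ g ∈ N.pi fun _ => C, μ.real (E g) = (p : ℝ) ^ N.card := by
    intro g hg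
    rw [Finset.mem_pi] at hg
    let F : Finset (Sym2 V) := N.attach.image fun v => s(g v.1 v.2, v.1)
    have hF : F.card = N.card := by
      rw [Finset.card_image_of_injective, Finset.card_attach]
      rintro ⟨v, hv⟩ ⟨w, hw⟩ hvw
      rcases Sym2.eq_iff.1 hvw with ⟨-, h2⟩ | ⟨h1, -⟩
      · exact Subtype.ext h2
      · exact absurd h1 (hCN _ (hg v hv) _ hw)
    rw [← hF, ← binomialRandom_real_forall_mem p F]
    · congr 1
      ext G
      simp only [Set.mem_ofPred_eq, F, E, Finset.forall_mem_image, Finset.mem_attach,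
        Subtype.forall, SimpleGraph.mem_edgeSet, forall_const]
    · simp only [F, Finset.mem_image]
      rintro _ ⟨⟨v, hv⟩, -, rfl⟩
      simpa using hCN _ (hg v hv) _ hv
  calc μ.real _ ≤ μ.real (⋃ g ∈ N.pi fun _ => C, E g) :=
      measureReal_mono hsub (measure_ne_top (SimpleGraph.binomialRandom V p) _)
    _ ≤ ∑ g ∈ N.pi fun _ => C, μ.real (E g) := measureReal_biUnion_finset_le _ _
    _ = (N.pi fun _ => C).card * (p : ℝ) ^ N.card := by
      rw [Finset.sum_congr rfl hE, Finset.sum_const, nsmul_eq_mul]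
    _ = _ := by rw [Finset.card_pi]; simp [mul_pow]

end

section
variable [Fintype V] (p : I)

theorem card_finset_prod_finset (V : Type*) [Fintype V] :
    (Fintype.card (Finset V × Finset V) : ℝ) = 4 ^ Fintype.card V := by
  rw [Fintype.card_prod, Fintype.card_finset]
  push_cast
  rw [← mul_pow]
  norm_num

theorem binomialRandom_real_not_joinsLarge_le (a b : ℕ) :
    (SimpleGraph.binomialRandom V p).real {G | ¬ JoinsLarge G a b} ≤
      4 ^ Fintype.card V * (1 - p : ℝ) ^ (a * b) := by
  classical
  let μ := SimpleGraph.binomialRandom V p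
  let E : Finset V × Finset V → Set (SimpleGraph V) := fun x =>
    {G | Disjoint x.1 x.2 ∧ a ≤ x.1.card ∧ b ≤ x.2.card ∧ ∀ u ∈ x.1, ∀ v ∈ x.2, ¬ G.Adj u v}
  have hsub : {G : SimpleGraph V | ¬ JoinsLarge G a b} ⊆ ⋃ x ∈ Finset.univ, E x := by
    intro G hG
    simp only [JoinsLarge, Set.mem_ofPred_eq] at hG
    push Not at hG
    obtain ⟨A, B, h⟩ := hG
    simp only [Set.mem_iUnion]
    exact ⟨(A, B), Finset.mem_univ _, h⟩
  have hp0 : (0 : ℝ) ≤ 1 - p := sub_nonneg.2 p.2.2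
  have hE : ∀ x ∈ Finset.univ, μ.real (E x) ≤ (1 - p : ℝ) ^ (a * b) := by
    rintro ⟨A, B⟩ -
    by_cases h : Disjoint A B ∧ a ≤ A.card ∧ b ≤ B.card
    · calc μ.real (E (A, B)) ≤ μ.real {G | ∀ u ∈ A, ∀ v ∈ B, ¬ G.Adj u v} :=
            measureReal_mono fun G hG => hG.2.2.2
        _ = (1 - p : ℝ) ^ (A.card * B.card) := binomialRandom_real_no_edge_between p h.1
        _ ≤ _ := pow_le_pow_of_le_one hp0 (by linarith [p.2.1]) (Nat.mul_le_mul h.2.1 h.2.2)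
    · have : E (A, B) = ∅ := by
        ext G
        simp only [E, Set.mem_ofPred_eq, Set.mem_empty_iff_false, iff_false]
        tauto
      rw [this]
      simpa using pow_nonneg hp0 _
  calc μ.real _ ≤ μ.real (⋃ x ∈ Finset.univ, E x) :=
      measureReal_mono hsub (measure_ne_top (SimpleGraph.binomialRandom V p) _)
    _ ≤ ∑ x, μ.real (E x) := measureReal_biUnion_finset_le _ _
    _ ≤ ∑ _x : Finset V × Finset V, (1 - p : ℝ) ^ (a * b) := Finset.sum_le_sum hE
    _ = _ := by
      rw [Finset.sum_const, nsmul_eq_mul, Finset.card_univ, card_finset_prod_finset]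

/-- Any `k` vertices have fewer than `q` neighbours apart from themselves. -/
def SmallBoundaries (G : SimpleGraph V) (k q : ℕ) : Prop :=
  ∀ C N : Finset V, C.card ≤ k → Disjoint C N → (∀ v ∈ N, ∃ u ∈ C, G.Adj u v) → N.card < q

theorem binomialRandom_real_not_smallBoundaries_le (k q : ℕ) (hkp : (k * p : ℝ) ≤ 1) :
    (SimpleGraph.binomialRandom V p).real {G | ¬ SmallBoundaries G k q} ≤
      4 ^ Fintype.card V * (k * p : ℝ) ^ q := by
  classical
  let μ := SimpleGraph.binomialRandom V p
  let E : Finset V × Finset V → Set (SimpleGraph V) := fun x =>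
    {G | x.1.card ≤ k ∧ Disjoint x.1 x.2 ∧ (∀ v ∈ x.2, ∃ u ∈ x.1, G.Adj u v) ∧ q ≤ x.2.card}
  have hsub : {G : SimpleGraph V | ¬ SmallBoundaries G k q} ⊆ ⋃ x ∈ Finset.univ, E x := by
    intro G hG
    simp only [SmallBoundaries, Set.mem_ofPred_eq] at hG
    push Not at hG
    obtain ⟨A, B, h⟩ := hG
    simp only [Set.mem_iUnion]
    exact ⟨(A, B), Finset.mem_univ _, h⟩
  have hp0 : (0 : ℝ) ≤ p := p.2.1
  have hE : ∀ x ∈ Finset.univ, μ.real (E x) ≤ (k * p : ℝ) ^ q := by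
    rintro ⟨A, B⟩ -
    by_cases h : A.card ≤ k ∧ Disjoint A B ∧ q ≤ B.card
    · calc μ.real (E (A, B)) ≤ μ.real {G | ∀ v ∈ B, ∃ u ∈ A, G.Adj u v} :=
            measureReal_mono fun G hG => hG.2.2.1
        _ ≤ (A.card * p : ℝ) ^ B.card := binomialRandom_real_dominated_le p h.2.1
        _ ≤ (k * p : ℝ) ^ B.card := by
          have : (A.card : ℝ) ≤ k := by exact_mod_cast h.1
          gcongr
        _ ≤ _ := pow_le_pow_of_le_one (by positivity) hkp h.2.2
    · have : E (A, B) = ∅ := by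
        ext G
        simp only [E, Set.mem_ofPred_eq, Set.mem_empty_iff_false, iff_false]
        tauto
      rw [this]
      simp only [measureReal_empty]
      positivity
  calc μ.real _ ≤ μ.real (⋃ x ∈ Finset.univ, E x) :=
      measureReal_mono hsub (measure_ne_top (SimpleGraph.binomialRandom V p) _)
    _ ≤ ∑ x, μ.real (E x) := measureReal_biUnion_finset_le _ _
    _ ≤ ∑ _x : Finset V × Finset V, (k * p : ℝ) ^ q := Finset.sum_le_sum hE
    _ = _ := by
      rw [Finset.sum_const, nsmul_eq_mul, Finset.card_univ, card_finset_prod_finset]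

end

/-! ### Robust graphs -/

/-- The two properties of sparse random graphs on which the robber relies: large sets are joined by
edges, where "large" means size `a` on one side and more than a tenth of all vertices on the other
side, and `k` vertices never have more than a fifth of all vertices as neighbours. -/
structure Robust [Fintype V] (G : SimpleGraph V) (k a : ℕ) : Prop where
  joinsLarge : JoinsLarge G a (Fintype.card V / 10 + 1)
  smallBoundaries : SmallBoundaries G k (Fintype.card V / 5 + 1)

theorem SmallBoundaries.card_closedNbhd_le [Fintype V] {G : SimpleGraph V} {k q : ℕ}
    (h : SmallBoundaries G k (q + 1)) {C : Finset V} (hC : C.card ≤ k) :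
    (closedNbhd G C).card ≤ q + k := by
  classical
  have h1 := h C (closedNbhd G C \ C) hC Finset.disjoint_sdiff fun v hv => by
    obtain ⟨hv, hvC⟩ := Finset.mem_sdiff.1 hv
    obtain ⟨u, hu, rfl | huv⟩ := mem_closedNbhd.1 hv
    · exact absurd hu hvC
    · exact ⟨u, hu, huv⟩
  have h2 := Finset.card_sdiff_add_card_eq_card (subset_closedNbhd (G := G) C)
  omega

theorem JoinsLarge.mono {G H : SimpleGraph V} {a b : ℕ} (hG : JoinsLarge G a b) (h : G ≤ H) :
    JoinsLarge H a b := fun A B hd hA hB =>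
  let ⟨u, hu, v, hv, huv⟩ := hG A B hd hA hB
  ⟨u, hu, v, hv, h huv⟩

/-- The growth factor is `F = n / (4 * a)`, so that sets of size `2 * a` cannot fail to expand by
running out of vertices. -/
theorem JoinsLarge.robberEscapes_of_card_closedNbhd_le [Fintype V] {G : SimpleGraph V} {n k a m : ℕ}
    (hn : Fintype.card V = n) (hG : JoinsLarge G a (n / 10 + 1))
    (hs : ∀ C : Finset V, C.card ≤ k → (closedNbhd G C).card ≤ n / 5 + 3 * k)
    (h50 : 50 ≤ n) (ha : 0 < a) (hka : 3 * k ≤ a) (han : 9 * a ≤ n)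
    (hm : a ≤ (n / (4 * a)) ^ m) {R : ℝ≥0∞} (hR : ((m + 1 : ℕ) : ℝ≥0∞) ≤ R)
    {k' : ℕ} (hk' : k' ≤ k) : RobberEscapes G R k' := by
  classical
  have hdiv : 4 * a * (n / (4 * a)) ≤ n := Nat.mul_div_le _ _
  refine hG.robberEscapes ha (s := n / 5 + a) (m := m) (F := n / (4 * a))
    (fun C hC => (hs C (hC.trans hk')).trans (by omega)) ?_ ?_ hm hR
  · have : 2 * (2 * a * (n / (4 * a))) ≤ n := by linarith
    omega
  · omega

/-- Adding a path adds at most two neighbours for each vertex. -/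
theorem card_closedNbhd_sup_pathGraph_le {n : ℕ} (G : SimpleGraph (Fin n)) (C : Finset (Fin n)) :
    (closedNbhd (G ⊔ SimpleGraph.pathGraph n) C).card ≤ (closedNbhd G C).card + 2 * C.card := by
  let f : Fin n → Fin n := fun u => if h : u.val + 1 < n then ⟨u + 1, h⟩ else u
  let g : Fin n → Fin n := fun u => ⟨u - 1, by omega⟩
  have hsub : closedNbhd (G ⊔ SimpleGraph.pathGraph n) C ⊆
      closedNbhd G C ∪ (C.image f ∪ C.image g) := by
    intro v hv
    simp only [Finset.mem_union, Finset.mem_image, mem_closedNbhd, SimpleGraph.sup_adj,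
      SimpleGraph.pathGraph_adj] at hv ⊢
    obtain ⟨u, hu, h | h | h | h⟩ := hv
    · exact .inl ⟨u, hu, .inl h⟩
    · exact .inl ⟨u, hu, .inr h⟩
    · refine .inr (.inl ⟨u, hu, ?_⟩)
      have := v.2
      simp only [f, dif_pos (show u.val + 1 < n by omega)]
      exact Fin.ext h
    · refine .inr (.inr ⟨u, hu, Fin.ext ?_⟩)
      simp only [g]
      omega
  have h1 := Finset.card_le_card hsub
  have h2 := Finset.card_union_le (closedNbhd G C) (C.image f ∪ C.image g)
  have h3 := Finset.card_union_le (C.image f) (C.image g)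
  have h4 := Finset.card_image_le (s := C) (f := f)
  have h5 := Finset.card_image_le (s := C) (f := g)
  omega

/-! ### Random graphs are robust -/

theorem whp_of_real_compl_le {p : ℕ → ℝ} {P : ∀ n : ℕ, SimpleGraph (Fin n) → Prop} {δ : ℕ → ℝ}
    (hδ : Tendsto δ atTop (𝓝 0))
    (h : ∀ᶠ n : ℕ in atTop, (SimpleGraph.binomialRandom (Fin n)
      (Set.projIcc (0 : ℝ) 1 zero_le_one (p n))).real {G | ¬ P n G} ≤ δ n) : Whp p P := by
  have hreal : Tendsto (fun n : ℕ => (SimpleGraph.binomialRandom (Fin n)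
      (Set.projIcc (0 : ℝ) 1 zero_le_one (p n))).real {G | P n G}) atTop (𝓝 1) := by
    have h1 : Tendsto (fun n => 1 - δ n) atTop (𝓝 1) := by simpa using hδ.const_sub 1
    refine tendsto_of_tendsto_of_tendsto_of_le_of_le' h1 tendsto_const_nhds ?_
      (.of_forall fun n => measureReal_le_one)
    filter_upwards [h] with n hn
    have hu := measureReal_union_le (μ := SimpleGraph.binomialRandom (Fin n)
      (Set.projIcc (0 : ℝ) 1 zero_le_one (p n))) {G | P n G} {G | ¬ P n G}
    have e : {G | P n G} ∪ {G | ¬ P n G} = Set.univ := by ext G; simp [em]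
    rw [e, probReal_univ] at hu
    linarith
  have h2 := ENNReal.tendsto_ofReal hreal
  simpa [Whp, ofReal_measureReal] using h2

theorem Whp.mono {p : ℕ → ℝ} {P Q : ∀ n : ℕ, SimpleGraph (Fin n) → Prop} (hP : Whp p P)
    (h : ∀ᶠ n : ℕ in atTop, ∀ G, P n G → Q n G) : Whp p Q := by
  refine tendsto_of_tendsto_of_tendsto_of_le_of_le' hP tendsto_const_nhds ?_
    (.of_forall fun n => prob_le_one)
  filter_upwards [h] with n hn
  exact measure_mono fun G hG => hn G hG

theorem Whp.eventually_exists {p : ℕ → ℝ} {P : ∀ n : ℕ, SimpleGraph (Fin n) → Prop}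
    (hP : Whp p P) : ∀ᶠ n : ℕ in atTop, ∃ G, P n G := by
  filter_upwards [hP.eventually_ne one_ne_zero] with n hn
  exact nonempty_of_measure_ne_zero hn

/-- There are `4 ^ n` pairs of vertex sets. The union bound over them succeeds for large sets
because `4 * exp (-2) < 1`, and for neighbourhoods because `4 ^ 5 * (1 / 3200) < 1`. -/
theorem whp_robust {p : ℕ → ℝ} {k a : ℕ → ℕ}
    (h : ∀ᶠ n : ℕ in atTop, (0 ≤ p n ∧ p n ≤ 1) ∧ k n * p n ≤ 1 / 3200 ∧ 20 ≤ p n * a n) :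
    Whp p fun n G => Robust G (k n) (a n) := by
  have hexp : 4 * Real.exp (-2) < 1 := by
    have h1 : (2.7 : ℝ) < Real.exp 1 := lt_trans (by norm_num) Real.exp_one_gt_d9
    have h2 : Real.exp 2 = Real.exp 1 * Real.exp 1 := by rw [← Real.exp_add]; norm_num
    rw [Real.exp_neg, ← div_eq_mul_inv, div_lt_one (Real.exp_pos _), h2]
    nlinarith
  have hdiv : Tendsto (fun n : ℕ => n / 5 + 1) atTop atTop :=
    tendsto_atTop_mono (fun n => by omega)
      (Nat.tendsto_div_const_atTop (by norm_num : (5 : ℕ) ≠ 0))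
  refine whp_of_real_compl_le
    (δ := fun n => (4 * Real.exp (-2)) ^ n + (8 / 25 : ℝ) ^ (n / 5 + 1)) ?_ ?_
  · simpa using (tendsto_pow_atTop_nhds_zero_of_lt_one (by positivity) hexp).add
      ((tendsto_pow_atTop_nhds_zero_of_lt_one (r := (8 / 25 : ℝ)) (by norm_num)
        (by norm_num)).comp hdiv)
  filter_upwards [h] with n hn
  obtain ⟨hp, hk, ha⟩ := hn
  set P := Set.projIcc (0 : ℝ) 1 zero_le_one (p n)
  have hP : (P : ℝ) = p n := by simp [P, Set.projIcc_of_mem zero_le_one (Set.mem_Icc.2 hp)]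
  have hsub : {G : SimpleGraph (Fin n) | ¬ Robust G (k n) (a n)} ⊆
      {G | ¬ JoinsLarge G (a n) (n / 10 + 1)} ∪ {G | ¬ SmallBoundaries G (k n) (n / 5 + 1)} := by
    intro G hG
    by_contra hno
    simp only [Set.mem_union, Set.mem_ofPred_eq, not_or, not_not] at hno
    exact hG ⟨by simpa using hno.1, by simpa using hno.2⟩
  have h1 := binomialRandom_real_not_joinsLarge_le (V := Fin n) P (a n) (n / 10 + 1)
  have h2 := binomialRandom_real_not_smallBoundaries_le (V := Fin n) P (k n) (n / 5 + 1)
    (by rw [hP]; linarith)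
  rw [hP, Fintype.card_fin] at h1 h2
  have h3 : (1 - p n) ^ (a n * (n / 10 + 1)) ≤ Real.exp (-2) ^ n := by
    have hb : (n : ℝ) ≤ 10 * ((n / 10 + 1 : ℕ) : ℝ) := by
      exact_mod_cast (show n ≤ 10 * (n / 10 + 1) by omega)
    calc (1 - p n) ^ (a n * (n / 10 + 1)) ≤ Real.exp (-p n) ^ (a n * (n / 10 + 1)) :=
          pow_le_pow_left₀ (by linarith) (Real.one_sub_le_exp_neg _) _
      _ = Real.exp (-(p n * a n * (n / 10 + 1 : ℕ))) := by
          rw [← Real.exp_nat_mul]; congr 1; push_cast; ring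
      _ ≤ Real.exp (n * (-2)) := by
          apply Real.exp_le_exp.2
          nlinarith [Nat.cast_nonneg (α := ℝ) (n / 10 + 1)]
      _ = _ := Real.exp_nat_mul _ _
  have h4 : (4 : ℝ) ^ n * (k n * p n) ^ (n / 5 + 1) ≤ (8 / 25 : ℝ) ^ (n / 5 + 1) := by
    calc (4 : ℝ) ^ n * (k n * p n) ^ (n / 5 + 1)
        ≤ 4 ^ (5 * (n / 5 + 1)) * (1 / 3200) ^ (n / 5 + 1) := by
          have := mul_nonneg (Nat.cast_nonneg (α := ℝ) (k n)) hp.1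
          gcongr
          · norm_num
          · omega
      _ = _ := by rw [pow_mul, ← mul_pow]; norm_num
  calc _ ≤ _ := measureReal_mono hsub
    _ ≤ _ := measureReal_union_le _ _
    _ ≤ _ := add_le_add (h1.trans ?_) (h2.trans h4)
  rw [mul_pow]
  gcongr

/-! ### Choice of parameters -/

open Real in
/-- The parameters for finite speed. Sets of size `a` are those to which a vertex sends at least
`20` edges on average. The growth factor `n / (4 * a)` has order `n ^ c` and `a` has order `n ^ (1 - c)`,
so `m` expansion steps suffice once `c * m > 1 - c`. -/
theorem eventually_parameters {c l : ℝ} (hc : 0 < c) (hc1 : c ≤ 1) (hl : 0 < l)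
    (hl1 : l ≤ 1 / 3200) {m : ℕ} (hm : 1 - c < c * m) :
    ∀ᶠ n : ℕ in atTop, let k := ⌊(n : ℝ) ^ (1 - c)⌋₊; let a := ⌈20 / l * (n : ℝ) ^ (1 - c)⌉₊
      ((0 ≤ l * (n : ℝ) ^ (c - 1) ∧ l * (n : ℝ) ^ (c - 1) ≤ 1) ∧
        k * (l * (n : ℝ) ^ (c - 1)) ≤ 1 / 3200 ∧ 20 ≤ l * (n : ℝ) ^ (c - 1) * a) ∧
      50 ≤ n ∧ 0 < a ∧ 3 * k ≤ a ∧ 9 * a ≤ n ∧ a ≤ (n / (4 * a)) ^ m := by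
  set L := 20 / l with hL
  have hL1 : 3 ≤ L := by rw [hL, le_div_iff₀ hl]; linarith
  have t1 : ∀ᶠ n : ℕ in atTop, 18 * L ≤ (n : ℝ) ^ c :=
    ((tendsto_rpow_atTop hc).comp tendsto_natCast_atTop_atTop).eventually_ge_atTop _
  have t2 : ∀ᶠ n : ℕ in atTop, 2 * L * (16 * L) ^ m ≤ (n : ℝ) ^ (c * m - (1 - c)) :=
    ((tendsto_rpow_atTop (sub_pos.2 hm)).comp
      tendsto_natCast_atTop_atTop).eventually_ge_atTop _
  filter_upwards [t1, t2, eventually_ge_atTop 50] with n h1 h2 h50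
  intro k a
  have hn : (1 : ℝ) ≤ n := by exact_mod_cast (by omega : 1 ≤ n)
  have hn0 : (0 : ℝ) < n := by linarith
  set x := (n : ℝ) ^ (1 - c) with hx
  set y := (n : ℝ) ^ c with hy
  have hx1 : 1 ≤ x := one_le_rpow hn (by linarith)
  have hxy : x * y = n := by rw [hx, hy, ← rpow_add hn0]; simp
  have hxi : x * (n : ℝ) ^ (c - 1) = 1 := by rw [hx, ← rpow_add hn0]; simp
  have hz0 : 0 < (n : ℝ) ^ (c - 1) := rpow_pos_of_pos hn0 _
  have hz1 : (n : ℝ) ^ (c - 1) ≤ 1 := rpow_le_one_of_one_le_of_nonpos hn (by linarith)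
  set z := (n : ℝ) ^ (c - 1) with hz
  have hkx : (k : ℝ) ≤ x := Nat.floor_le (by linarith)
  have hax : L * x ≤ a := Nat.le_ceil _
  have hLx : 1 ≤ L * x := by nlinarith
  have hax2 : (a : ℝ) ≤ 2 * L * x := by
    have := (Nat.ceil_lt_add_one (show 0 ≤ L * x by linarith)).le
    change (a : ℝ) ≤ _ at this
    linarith
  have ha9 : (9 * a : ℝ) ≤ n := by rw [← hxy]; nlinarith
  have ha0 : (0 : ℝ) < a := by linarith
  have hlL : l * L = 20 := by rw [hL]; field_simp
  refine ⟨⟨⟨by positivity, by nlinarith⟩, ?_, ?_⟩, h50, by exact_mod_cast ha0, ?_,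
    by exact_mod_cast ha9, ?_⟩
  · calc (k : ℝ) * (l * z) ≤ x * (l * z) := by gcongr
      _ = l * (x * z) := by ring
      _ ≤ _ := by rw [hxi]; linarith
  · calc (20 : ℝ) = l * L * (x * z) := by rw [hlL, hxi]; ring
      _ = l * z * (L * x) := by ring
      _ ≤ _ := by gcongr
  · have : (3 * k : ℝ) ≤ a := by nlinarith
    exact_mod_cast this
  · have hF : y / (16 * L) ≤ ((n / (4 * a) : ℕ) : ℝ) := by
      have e1 : n < 4 * a * (n / (4 * a) + 1) := by
        have := Nat.div_add_mod n (4 * a)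
        have := Nat.mod_lt n (show 0 < 4 * a by have : 0 < a := by exact_mod_cast ha0
                                                omega)
        linarith
      have e2 : (n : ℝ) < 4 * a * (((n / (4 * a) : ℕ) : ℝ) + 1) := by exact_mod_cast e1
      have e3 : (n : ℝ) ≤ 8 * a * ((n / (4 * a) : ℕ) : ℝ) := by nlinarith
      have e4 : (n : ℝ) ≤ 16 * L * x * ((n / (4 * a) : ℕ) : ℝ) :=
        e3.trans (by gcongr ?_ * _; linarith)
      rw [← hxy] at e4
      rw [div_le_iff₀ (by linarith)]
      have e5 : x * y ≤ x * (((n / (4 * a) : ℕ) : ℝ) * (16 * L)) := by linarith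
      exact le_of_mul_le_mul_left e5 (by linarith)
    have hfin : (a : ℝ) ≤ ((n / (4 * a) : ℕ) : ℝ) ^ m := by
      calc (a : ℝ) ≤ 2 * L * x := hax2
        _ = 2 * L * (16 * L) ^ m * x / (16 * L) ^ m := by field_simp
        _ ≤ (n : ℝ) ^ (c * m - (1 - c)) * x / (16 * L) ^ m := by gcongr
        _ = (y / (16 * L)) ^ m := by
          rw [hx, ← rpow_add hn0, div_pow, hy, ← rpow_natCast ((n : ℝ) ^ c), ← rpow_mul hn0.le]
          congr 2
          ring
        _ ≤ _ := by gcongr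
    exact_mod_cast hfin

/-- The parameters for infinite speed. Here the growth factor `n / (4 * a)` is only bounded below by
`2`, which is enough for `n` steps. -/
theorem eventually_parameters_infinite :
    ∀ᶠ n : ℕ in atTop, let k := ⌊(n : ℝ) / 800 ^ 2⌋₊; let a := n / 10 + 1
      ((0 ≤ 200 / (n : ℝ) ∧ 200 / (n : ℝ) ≤ 1) ∧
        k * (200 / (n : ℝ)) ≤ 1 / 3200 ∧ 20 ≤ 200 / (n : ℝ) * a) ∧
      50 ≤ n ∧ 0 < a ∧ 3 * k ≤ a ∧ 9 * a ≤ n ∧ a ≤ (n / (4 * a)) ^ n := by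
  filter_upwards [eventually_ge_atTop 1000] with n hn
  intro k a
  have hn' : (1000 : ℝ) ≤ n := by exact_mod_cast hn
  have hk : (k : ℝ) ≤ n / 800 ^ 2 := Nat.floor_le (by positivity)
  have ha : (n : ℝ) ≤ 10 * a := by exact_mod_cast (show n ≤ 10 * (n / 10 + 1) by omega)
  have h9 : 9 * a ≤ n := by omega
  refine ⟨⟨⟨by positivity, by rw [div_le_one (by linarith)]; linarith⟩, ?_, ?_⟩, by omega,
    by omega, ?_, h9, ?_⟩
  · calc (k : ℝ) * (200 / n) ≤ n / 800 ^ 2 * (200 / n) := by gcongr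
      _ = 1 / 3200 := by field_simp; norm_num
  · rw [div_mul_eq_mul_div, le_div_iff₀ (by linarith)]
    linarith
  · have : (3 * k : ℝ) ≤ a := by linarith
    exact_mod_cast this
  · have h2 : 2 ≤ n / (4 * a) := by
      rw [Nat.le_div_iff_mul_le (by omega)]
      omega
    calc a ≤ n := by omega
      _ ≤ 2 ^ n := Nat.lt_two_pow_self.le
      _ ≤ _ := Nat.pow_le_pow_left h2 n

/-! ### Escaping on random graphs and on connected graphs -/

/-- With suitable parameters, the robber escapes whp on the random graph, and for large `n` he also
escapes on some connected graph: the union of a robust graph with a Hamiltonian path. -/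
theorem whp_and_exists_of_parameters {p x : ℕ → ℝ} {a m : ℕ → ℕ} {R : ℝ≥0∞}
    (h : ∀ᶠ n : ℕ in atTop, let k := ⌊x n⌋₊
      ((0 ≤ p n ∧ p n ≤ 1) ∧ k * p n ≤ 1 / 3200 ∧ 20 ≤ p n * a n) ∧
      50 ≤ n ∧ 0 < a n ∧ 3 * k ≤ a n ∧ 9 * a n ≤ n ∧ a n ≤ (n / (4 * a n)) ^ m n)
    (hR : ∀ n, ((m n + 1 : ℕ) : ℝ≥0∞) ≤ R) :
    Whp p (fun n G => ∀ k : ℕ, (k : ℝ) ≤ x n → RobberEscapes G R k) ∧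
    ∀ᶠ n : ℕ in atTop, ∃ G : SimpleGraph (Fin n), G.Connected ∧ x n ≤ copNumber G R := by
  have hw := whp_robust (p := p) (k := fun n => ⌊x n⌋₊) (a := a) (h.mono fun n hn => hn.1)
  refine ⟨hw.mono ?_, ?_⟩
  · filter_upwards [h] with n hn G hG k hk
    obtain ⟨-, h50, ha, hka, han, hm⟩ := hn
    have hJ := hG.joinsLarge
    have hB := hG.smallBoundaries
    rw [Fintype.card_fin] at hJ hB
    refine hJ.robberEscapes_of_card_closedNbhd_le (Fintype.card_fin n)
      (fun C hC => (hB.card_closedNbhd_le hC).trans ?_) h50 ha hka han hm (hR n) (Nat.le_floor hk)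
    omega
  · filter_upwards [h, hw.eventually_exists] with n hn ⟨G, hG⟩
    obtain ⟨-, h50, ha, hka, han, hm⟩ := hn
    have hJ := hG.joinsLarge
    have hB := hG.smallBoundaries
    rw [Fintype.card_fin] at hJ hB
    refine ⟨G ⊔ SimpleGraph.pathGraph n, ?_, (lt_copNumber fun k hk => ?_).le⟩
    · obtain ⟨n, rfl⟩ : ∃ n', n = n' + 1 := ⟨n - 1, by omega⟩
      exact (SimpleGraph.pathGraph_connected n).mono le_sup_right
    refine (hJ.mono le_sup_left).robberEscapes_of_card_closedNbhd_le (Fintype.card_fin n)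
      (fun C hC => ?_) h50 ha hka han hm (hR n) (Nat.le_floor hk)
    have h1 := card_closedNbhd_sup_pathGraph_le G C
    have h2 := hB.card_closedNbhd_le hC
    omega

theorem whp_and_exists_finite_speed {c : ℝ} (hc : 0 < c) :
    Whp (fun n => c ^ 3 / 30000 * (n : ℝ) ^ (c - 1)) (fun n G =>
      ∀ k : ℕ, (k : ℝ) ≤ (n : ℝ) ^ (1 - c) → RobberEscapes G (ENNReal.ofReal (1 / c + 2)) k) ∧
    ∀ᶠ n : ℕ in atTop, ∃ G : SimpleGraph (Fin n), G.Connected ∧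
      (n : ℝ) ^ (1 - c) ≤ copNumber G (ENNReal.ofReal (1 / c + 2)) := by
  rcases le_or_gt c 1 with hc1 | hc1
  · have hfl : 1 / c < (⌊1 / c⌋₊ + 1 : ℕ) := by exact_mod_cast Nat.lt_floor_add_one (1 / c)
    refine whp_and_exists_of_parameters (m := fun _ => ⌊1 / c⌋₊ + 1)
      (eventually_parameters hc hc1 (l := c ^ 3 / 30000) (by positivity) ?_ ?_) fun _ => ?_
    · have := pow_le_one₀ hc.le hc1 (n := 3)
      linarith
    · rw [div_lt_iff₀ hc] at hfl
      linarith
    · rw [← ENNReal.ofReal_natCast]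
      apply ENNReal.ofReal_le_ofReal
      have := Nat.floor_le (show 0 ≤ 1 / c by positivity)
      push_cast
      linarith
  · -- For `c > 1` there is less than one cop.
    have hesc : ∀ᶠ n : ℕ in atTop, ∀ G : SimpleGraph (Fin n), ∀ k : ℕ,
        (k : ℝ) ≤ (n : ℝ) ^ (1 - c) → RobberEscapes G (ENNReal.ofReal (1 / c + 2)) k := by
      filter_upwards [eventually_ge_atTop 2] with n hn G k hk
      have hlt : (n : ℝ) ^ (1 - c) < 1 :=
        Real.rpow_lt_one_of_one_lt_of_neg (by exact_mod_cast hn) (by linarith)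
      obtain rfl : k = 0 := by
        have : (k : ℝ) < 1 := hk.trans_lt hlt
        exact Nat.lt_one_iff.1 (by exact_mod_cast this)
      exact robberEscapes_zero G _ ⟨0, by omega⟩
    refine ⟨?_, ?_⟩
    · refine whp_of_real_compl_le (δ := fun _ => 0) tendsto_const_nhds ?_
      filter_upwards [hesc] with n hn
      have : {G : SimpleGraph (Fin n) | ¬ ∀ k : ℕ, (k : ℝ) ≤ (n : ℝ) ^ (1 - c) →
          RobberEscapes G (ENNReal.ofReal (1 / c + 2)) k} = ∅ :=
        Set.eq_empty_of_forall_notMem fun G hG => hG (hn G)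
      rw [this, measureReal_empty]
    · filter_upwards [hesc, eventually_ge_atTop 1] with n hn hn1
      obtain ⟨n, rfl⟩ : ∃ n', n = n' + 1 := ⟨n - 1, by omega⟩
      exact ⟨_, SimpleGraph.pathGraph_connected n, (lt_copNumber (hn _)).le⟩

theorem whp_and_exists_infinite_speed :
    Whp (fun n => 200 / (n : ℝ)) (fun n G =>
      ∀ k : ℕ, (k : ℝ) ≤ (n : ℝ) / 800 ^ 2 → RobberEscapes G ∞ k) ∧
    ∀ᶠ n : ℕ in atTop, ∃ G : SimpleGraph (Fin n), G.Connected ∧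
      (n : ℝ) / 800 ^ 2 ≤ copNumber G ∞ :=
  whp_and_exists_of_parameters (m := fun n => n) eventually_parameters_infinite fun _ => le_top

end CopsAndRobbers

theorem theorem4 :
    (∀ R : ℝ, 2 < R → ∀ᶠ n : ℕ in atTop, ∃ G : SimpleGraph (Fin n), G.Connected ∧
      (n : ℝ) ^ (1 - 1 / (R - 2)) ≤ (CopsAndRobbers.copNumber G (ENNReal.ofReal R) : ℝ)) ∧
    (∀ᶠ n : ℕ in atTop, ∃ G : SimpleGraph (Fin n), G.Connected ∧
      (n : ℝ) / 800 ^ 2 ≤ (CopsAndRobbers.copNumber G ∞ : ℝ)) ∧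
    (∀ c : ℝ, 0 < c →
      CopsAndRobbers.Whp (fun n => c ^ 3 / 30000 * (n : ℝ) ^ (c - 1)) fun n G =>
        ∀ k : ℕ, (k : ℝ) ≤ (n : ℝ) ^ (1 - c) →
          CopsAndRobbers.RobberEscapes G (ENNReal.ofReal (1 / c + 2)) k) ∧
    CopsAndRobbers.Whp (fun n => 200 / (n : ℝ)) (fun n G =>
      ∀ k : ℕ, (k : ℝ) ≤ (n : ℝ) / 800 ^ 2 → CopsAndRobbers.RobberEscapes G ∞ k) := by
  refine ⟨fun R hR => ?_, CopsAndRobbers.whp_and_exists_infinite_speed.2,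
    fun c hc => (CopsAndRobbers.whp_and_exists_finite_speed hc).1,
    CopsAndRobbers.whp_and_exists_infinite_speed.1⟩
  have h := (CopsAndRobbers.whp_and_exists_finite_speed
    (one_div_pos.2 (sub_pos.2 hR))).2
  rwa [one_div_one_div, sub_add_cancel] at h
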